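/- Among $N\ge 1$ identical-looking coins exactly one is fake; all the other coins have the same weight. The fake coin is an LHR-coin: at each moment it is in one of the states light, heavy, real, and when it is put on a balance scale it behaves as a coin lighter than, heavier than, or as heavy as the other coins, respectively. Each time it is on the scale its state moves one step in the cycle light $\to$ heavy $\to$ real $\to$ light; while it is off the scale its state does not change. Its starting state is unknown. A weighing puts equal numbers of coins on the two pans, and its result is $=$, $<$ (left pan lighter) or $>$ (right pan lighter). An adaptive strategy of $w$ weighings makes at most $w$ weighings, each of which may depend on the earlier results, and always identifies the fake coin (not necessarily its state), whichever coin is fake and whatever its starting state. For $n\ge 0$, let $\mathcal L_n,\mathcal H_n,\mathcal R_n$ be the sets of strings of length $n$ in the symbols $=,<,>$ that can occur as the sequence of results of $n$ weighings when the fake coin starts in the light, heavy, real state, respectively (for some choice, for each weighing, of whether the fake coin is on the left pan, on the right pan, or off the scale). Let $L_n=|\mathcal L_n|$, $R_n=|\mathcal R_n|$, $HR_n=|\mathcal H_n\cup\mathcal R_n|$ and $k_n=\min\{(HR_n-1)/2,\;R_n\}$. **Theorem.** Let $w>4$ and $N\ge1$. There exists an adaptive strategy of $w$ weighings that finds the fake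 coin among $N$ coins if and only if $$N\le k_{w-1}+\frac{L_{w-1}+1}{2}.$$ -/

import Mathlib

namespace LHRCoin

/-- The state of the fake coin: how it will behave the next time it is on the scale. -/
inductive State
  | light
  | heavy
  | real
  deriving DecidableEq

/-- The result of one weighing: `bal` is `=`, `lt` is `<` (the left pan is lighter),
`gt` is `>` (the right pan is lighter). -/
inductive Result
  | bal
  | lt
  | gt
  deriving DecidableEq

/-- The place of a coin during one weighing: on the left pan, on the right pan, or outside. -/
inductive Place
  | left
  | right
  | outside
  deriving DecidableEq

instance : Fintype Place where
  elems := {.left, .right, .outside}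
  complete := by intro p; cases p <;> decide

/-- The state after a weighing: each time the coin is on the scale, it moves one step in the
cycle light, heavy, real, light; outside the scale it keeps its state. -/
def State.after : State → Place → State
  | s, .outside => s
  | .light, _ => .heavy
  | .heavy, _ => .real
  | .real, _ => .light

/-- The result of a weighing with equally many coins on both pans, when the fake coin is in
the given state and at the given place. -/
def State.result : State → Place → Result
  | _, .outside => .bal
  | .real, _ => .bal
  | .light, .left => .lt
  | .light, .right => .gt
  | .heavy, .left => .gt
  | .heavy, .right => .lt

/-- The outcome (string of results) produced by a fake coin that starts in the state `s` and
follows the given itinerary. -/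
def outcome : State → List Place → List Result
  | _, [] => []
  | s, p :: ps => s.result p :: outcome (s.after p) ps

/-- The set of possible outcomes of length `n` for the starting state `s`: those produced by
some itinerary of length `n`. -/
def outcomes (s : State) (n : ℕ) : Finset (List Result) :=
  Finset.univ.image fun p : List.Vector Place n => outcome s p.toList

/-- `L_n`, the number of possible outcomes of length `n` for the light starting state. -/
def numL (n : ℕ) : ℕ := (outcomes .light n).card

/-- `R_n`, the number of possible outcomes of length `n` for the real starting state. -/
def numR (n : ℕ) : ℕ := (outcomes .real n).card

/-- `HR_n`, the number of outcomes of length `n` that are possible for the heavy or for the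
real starting state. -/
def numHR (n : ℕ) : ℕ := (outcomes .heavy n ∪ outcomes .real n).card

/-- `k_n = min {(HR_n - 1) / 2, R_n}`. -/
def kSeq (n : ℕ) : ℚ := min (((numHR n : ℚ) - 1) / 2) (numR n : ℚ)

/-- One weighing of some of `N` coins: the same number of coins is put on each pan. -/
structure Weighing (N : ℕ) where
  left : Finset (Fin N)
  right : Finset (Fin N)
  disjoint : Disjoint left right
  card_eq : left.card = right.card

/-- Where the coin `c` is during a weighing. -/
def Weighing.place {N : ℕ} (W : Weighing N) (c : Fin N) : Place :=
  if c ∈ W.left then .left else if c ∈ W.right then .right else .outside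

/-- An adaptive strategy for `N` coins with at most `w` weighings: either it stops and declares
a coin to be the fake one, or it makes a weighing and continues, depending on the result. -/
inductive Strategy (N : ℕ) : ℕ → Type
  | declare {w : ℕ} (c : Fin N) : Strategy N w
  | weigh {w : ℕ} (W : Weighing N) (next : Result → Strategy N w) : Strategy N (w + 1)

/-- The coin that the strategy declares to be fake when the fake coin is in fact `c`, and
its starting state is `s`. -/
def Strategy.run {N : ℕ} : {w : ℕ} → Strategy N w → Fin N → State → Fin N
  | _, .declare d, _, _ => d
  | _, .weigh W next, c, s =>
      (next (s.result (W.place c))).run c (s.after (W.place c))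

/-- The strategy finds the fake LHR-coin with unknown starting state: whichever coin is fake, and
whatever its starting state, this coin is the one declared. -/
def Strategy.FindsFake {N w : ℕ} (S : Strategy N w) : Prop :=
  ∀ (c : Fin N) (s : State), S.run c s = c

end LHRCoin

/-! Write n = w - 1 and let a be the number of coins on each pan in the first weighing. Necessity:
after `<` the suspects are a heavy coins and a real ones, and different coins need different
outcomes, so 2a ≤ HR_n and a ≤ R_n. After `=` every coin may be light, and the N - 2a coins left
outside may also be real. For one coin, the light and the real outcome agree only if both are all
`=`, so N + (N - 2a) ≤ L_n + 1 (`Strategy.FindsFake.bounds`).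

Sufficiency: once a genuine coin is known, these counting conditions also suffice for light/heavy
and for heavy/real suspects (`lightHeavySolvable_and_heavyRealSolvable`, a joint induction). After a
balanced first weighing no coin is known to be genuine. The second weighing then takes all coins of
unknown state but one, together with light coins, so that each result clears some coin
(`solvable_second`). The coin left out is never weighed again while the scale balances
(`solvable_light_insert`). `solvable_of_le` fits the numbers. -/

namespace LHRCoin

/-! ### Outcome sets and their recursions. -/

/-- The strings with tail in `A`, `B`, `C` after the symbols `=`, `<`, `>` respectively. -/
def consUnion (A B C : Finset (List Result)) : Finset (List Result) :=
  A.image (List.cons .bal) ∪ B.image (List.cons .lt) ∪ C.image (List.cons .gt)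

theorem card_consUnion (A B C : Finset (List Result)) :
    (consUnion A B C).card = A.card + B.card + C.card := by
  have inj (x : Result) : Function.Injective (List.cons x) := List.cons_injective
  rw [consUnion, Finset.card_union_of_disjoint, Finset.card_union_of_disjoint,
    Finset.card_image_of_injective _ (inj _), Finset.card_image_of_injective _ (inj _),
    Finset.card_image_of_injective _ (inj _)]
  · rw [Finset.disjoint_left]; simp
  · rw [Finset.disjoint_left]
    simp only [Finset.mem_union, Finset.mem_image]
    rintro _ (⟨_, _, rfl⟩ | ⟨_, _, rfl⟩) <;> simp

theorem consUnion_union (A B C A' B' C' : Finset (List Result)) :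
    consUnion A B C ∪ consUnion A' B' C' = consUnion (A ∪ A') (B ∪ B') (C ∪ C') := by
  simp only [consUnion, Finset.image_union]
  ac_rfl

theorem mem_outcomes {s : State} {n : ℕ} {x : List Result} :
    x ∈ outcomes s n ↔ ∃ p : List Place, p.length = n ∧ outcome s p = x := by
  simp only [outcomes, Finset.mem_image, Finset.mem_univ, true_and]
  exact ⟨fun ⟨p, hp⟩ => ⟨p.toList, p.toList_length, hp⟩, fun ⟨p, hp, h⟩ => ⟨⟨p, hp⟩, h⟩⟩

theorem outcomes_zero (s : State) : outcomes s 0 = {[]} := by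
  ext x
  simp [mem_outcomes, List.length_eq_zero_iff, outcome, eq_comm]

theorem mem_outcomes_succ {s : State} {n : ℕ} {x : List Result} :
    x ∈ outcomes s (n + 1) ↔
      ∃ p : Place, ∃ y ∈ outcomes (s.after p) n, s.result p :: y = x := by
  simp only [mem_outcomes]
  constructor
  · rintro ⟨_ | ⟨p, ps⟩, h, rfl⟩
    · simp at h
    · exact ⟨p, _, ⟨ps, by simpa using h, rfl⟩, rfl⟩
  · rintro ⟨p, _, ⟨ps, h, rfl⟩, rfl⟩
    exact ⟨p :: ps, by simpa using h, rfl⟩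

theorem exists_place {q : Place → Prop} : (∃ p, q p) ↔ q .outside ∨ q .left ∨ q .right := by
  constructor
  · rintro ⟨_ | _ | _, h⟩ <;> simp [h]
  · rintro (h | h | h) <;> exact ⟨_, h⟩

theorem outcomes_light_succ (n : ℕ) : outcomes .light (n + 1) =
    consUnion (outcomes .light n) (outcomes .heavy n) (outcomes .heavy n) := by
  ext x
  simp [mem_outcomes_succ, exists_place, State.after, State.result, consUnion]

theorem outcomes_heavy_succ (n : ℕ) : outcomes .heavy (n + 1) =
    consUnion (outcomes .heavy n) (outcomes .real n) (outcomes .real n) := by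
  ext x
  simp [mem_outcomes_succ, exists_place, State.after, State.result, consUnion]
  rw [or_comm (a := ∃ y ∈ outcomes State.real n, Result.gt :: y = x)]

theorem outcomes_real_succ' (n : ℕ) : outcomes .real (n + 1) =
    consUnion (outcomes .real n ∪ outcomes .light n) ∅ ∅ := by
  ext x
  simp [mem_outcomes_succ, exists_place, State.after, State.result, consUnion, or_and_right,
    exists_or]

/-- A real coin gives `=` whether weighed or not, and at best becomes light; a light coin imitates
this by staying outside. -/
theorem outcomes_real_subset_light (n : ℕ) : outcomes .real n ⊆ outcomes .light n := by
  induction n with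
  | zero => simp [outcomes_zero]
  | succ n ih =>
    rw [outcomes_real_succ', outcomes_light_succ, Finset.union_eq_right.2 ih]
    intro x
    simp +contextual [consUnion]

theorem outcomes_real_succ (n : ℕ) : outcomes .real (n + 1) =
    consUnion (outcomes .light n) ∅ ∅ := by
  rw [outcomes_real_succ', Finset.union_eq_right.2 (outcomes_real_subset_light n)]

/-! ### Recursions and inequalities for the counting sequences. -/

/-- The number of outcomes of length `n` that are possible for the light or for the heavy
starting state. -/
def numHL (n : ℕ) : ℕ := (outcomes .heavy n ∪ outcomes .light n).card

/-- The number of possible outcomes of length `n` for the heavy starting state. -/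
def numH (n : ℕ) : ℕ := (outcomes .heavy n).card

theorem numL_zero : numL 0 = 1 := by simp [numL, outcomes_zero]
theorem numH_zero : numH 0 = 1 := by simp [numH, outcomes_zero]
theorem numR_zero : numR 0 = 1 := by simp [numR, outcomes_zero]
theorem numHR_zero : numHR 0 = 1 := by simp [numHR, outcomes_zero]
theorem numHL_zero : numHL 0 = 1 := by simp [numHL, outcomes_zero]

theorem numL_succ (n : ℕ) : numL (n + 1) = numL n + 2 * numH n := by
  rw [numL, outcomes_light_succ, card_consUnion, numL, numH]; ring

theorem numH_succ (n : ℕ) : numH (n + 1) = numH n + 2 * numR n := by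
  rw [numH, outcomes_heavy_succ, card_consUnion, numR, numH]; ring

theorem numR_succ (n : ℕ) : numR (n + 1) = numL n := by
  rw [numR, outcomes_real_succ, card_consUnion, numL]; simp

theorem numHR_succ (n : ℕ) : numHR (n + 1) = numHL n + 2 * numR n := by
  rw [numHR, outcomes_heavy_succ, outcomes_real_succ, consUnion_union, card_consUnion,
    numHL, numR]
  simp; ring

theorem numHL_succ (n : ℕ) : numHL (n + 1) = numHL n + 2 * numHR n := by
  rw [numHL, outcomes_heavy_succ, outcomes_light_succ, consUnion_union, card_consUnion,
    numHL, numHR, Finset.union_comm (outcomes .real n)]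
  ring

theorem numL_le_numHL (n : ℕ) : numL n ≤ numHL n := Finset.card_le_card Finset.subset_union_right
theorem numH_le_numHL (n : ℕ) : numH n ≤ numHL n := Finset.card_le_card Finset.subset_union_left
theorem numH_le_numHR (n : ℕ) : numH n ≤ numHR n := Finset.card_le_card Finset.subset_union_left
theorem numR_le_numHR (n : ℕ) : numR n ≤ numHR n := Finset.card_le_card Finset.subset_union_right
theorem numR_le_numL (n : ℕ) : numR n ≤ numL n :=
  Finset.card_le_card (outcomes_real_subset_light n)

theorem one_le_numH (n : ℕ) : 1 ≤ numH n := by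
  induction n with
  | zero => simp [numH_zero]
  | succ n ih => rw [numH_succ]; omega

/-- Each bound feeds the other in the induction; two steps are needed because R_{n+1} = L_n. -/
theorem numH_le_numL_and (n : ℕ) : numH n ≤ numL n ∧ numL n ≤ 2 * numH n + 1 := by
  induction n using Nat.twoStepInduction with
  | zero => simp [numL_zero, numH_zero]
  | one => simp [numL_succ, numH_succ, numL_zero, numH_zero, numR_zero]
  | more n ih ih' =>
    have := one_le_numH n
    simp only [numL_succ, numH_succ, numR_succ] at *
    omega

theorem numH_le_numL (n : ℕ) : numH n ≤ numL n := (numH_le_numL_and n).1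

theorem numL_le_two_mul_numH (n : ℕ) : numL n ≤ 2 * numH n + 1 := (numH_le_numL_and n).2

/-- The all-balanced string lies in both sets of each union. -/
theorem numHL_numHR_lt (n : ℕ) :
    numHL n + 1 ≤ numL n + numH n ∧ numHR n + 1 ≤ numH n + numR n := by
  induction n with
  | zero => simp [numL_zero, numH_zero, numHL_zero, numHR_zero, numR_zero]
  | succ n ih => rw [numHL_succ, numHR_succ, numL_succ, numH_succ, numR_succ]; omega

theorem one_le_numL (n : ℕ) : 1 ≤ numL n := by
  induction n with
  | zero => simp [numL_zero]
  | succ n ih => rw [numL_succ]; omega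

theorem one_le_numR (n : ℕ) : 1 ≤ numR n := by
  cases n with
  | zero => simp [numR_zero]
  | succ n => rw [numR_succ]; exact one_le_numL n

theorem odd_numHL (n : ℕ) : numHL n % 2 = 1 := by
  induction n with
  | zero => simp [numHL_zero]
  | succ n ih => rw [numHL_succ]; omega

theorem odd_numHR (n : ℕ) : numHR n % 2 = 1 := by
  cases n with
  | zero => simp [numHR_zero]
  | succ n => have := odd_numHL n; rw [numHR_succ]; omega

theorem numR_le_numH (n : ℕ) : numR n ≤ numH n := by
  rcases n with _ | _ | n
  · simp [numH_zero, numR_zero]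
  · simp [numL_zero, numR_succ, numH_succ, numH_zero, numR_zero]
  · have := numH_le_numL n
    simp only [numR_succ, numH_succ, numL_succ]
    omega

theorem numH_le_three_mul_numR (n : ℕ) (hn : n ≠ 0) : numH n ≤ 3 * numR n := by
  obtain ⟨n, rfl⟩ := Nat.exists_eq_succ_of_ne_zero hn
  have := numH_le_numL n
  have := numR_le_numL n
  simp only [numR_succ, numH_succ]
  omega

theorem two_mul_numR_le (n : ℕ) : 2 * numR n ≤ numL n + 1 := by
  cases n with
  | zero => simp [numR_zero, numL_zero]
  | succ n =>
    have := numL_le_two_mul_numH n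
    simp only [numR_succ, numL_succ]
    omega

/-- Equality holds at n = 3 and the bound fails at n = 2; this and `three_mul_numH_lt` are where w >
4 enters. -/
theorem numL_add_three_le (n : ℕ) (hn : 3 ≤ n) : numL n + 3 ≤ 2 * numH n := by
  obtain ⟨m, rfl⟩ := Nat.exists_eq_add_of_le' hn
  have := numH_le_numL (m + 1)
  have := one_le_numL m
  have := one_le_numH m
  simp only [numR_succ, numH_succ, numL_succ] at *
  omega

theorem three_mul_numH_lt (n : ℕ) (hn : 3 ≤ n) : 3 * numH n + 1 ≤ 2 * numHR n + numR n := by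
  -- Five steps of the recursions reduce the claim to linear bounds at m, leaving n = 3 and n = 4 to
  -- compute.
  obtain rfl | rfl | ⟨m, rfl⟩ : n = 3 ∨ n = 4 ∨ ∃ m, n = m + 5 := by
    rcases Nat.lt_or_ge n 5 with h | h
    · omega
    · exact Or.inr (Or.inr ⟨n - 5, by omega⟩)
  · simp [numL_succ, numH_succ, numR_succ, numHR_succ, numHL_succ, numL_zero, numH_zero,
      numR_zero, numHR_zero, numHL_zero]
  · simp [numL_succ, numH_succ, numR_succ, numHR_succ, numHL_succ, numL_zero, numH_zero,
      numR_zero, numHR_zero, numHL_zero]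
  · have := numL_le_numHL m
    have := numH_le_numHR m
    have := two_mul_numR_le m
    have := numH_le_numL m
    have := numL_le_two_mul_numH m
    have := one_le_numR m
    simp only [numL_succ, numH_succ, numR_succ, numHR_succ, numHL_succ]
    omega

/-! ### Necessity. -/

/-- The results of the `w` weighings when the fake coin is `c` and starts in the state `s`; the
weighings that are not made count as balanced. -/
def Strategy.trace {N : ℕ} : {w : ℕ} → Strategy N w → Fin N → State → List Result
  | w, .declare _, _, _ => List.replicate w .bal
  | _, .weigh W next, c, s =>
      s.result (W.place c) :: (next (s.result (W.place c))).trace c (s.after (W.place c))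

theorem replicate_bal_mem_outcomes (n : ℕ) (s : State) :
    List.replicate n .bal ∈ outcomes s n := by
  induction n with
  | zero => simp [outcomes_zero]
  | succ n ih =>
    refine mem_outcomes_succ.2 ⟨.outside, List.replicate n .bal, ?_, ?_⟩
    · cases s <;> exact ih
    · cases s <;> rfl

theorem Strategy.trace_mem {N w : ℕ} (S : Strategy N w) (c : Fin N) (s : State) :
    S.trace c s ∈ outcomes s w := by
  induction S generalizing s with
  | declare d => exact replicate_bal_mem_outcomes _ s
  | weigh W next ih => exact mem_outcomes_succ.2 ⟨W.place c, _, ih _ _, rfl⟩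

theorem Strategy.run_eq_of_trace_eq {N w : ℕ} (S : Strategy N w) {c c' : Fin N} {s s' : State}
    (h : S.trace c s = S.trace c' s') : S.run c s = S.run c' s' := by
  induction S generalizing s s' with
  | declare d => rfl
  | weigh W next ih =>
    simp only [Strategy.trace, List.cons.injEq] at h
    obtain ⟨h₁, h₂⟩ := h
    simp only [Strategy.run]
    rw [h₁] at h₂ ⊢
    exact ih _ h₂

/-- The first time the coin is on the scale, light tips it and real does not. -/
theorem Strategy.trace_eq_replicate {N w : ℕ} (S : Strategy N w) {c : Fin N}
    (h : S.trace c .light = S.trace c .real) : S.trace c .light = List.replicate w .bal := by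
  induction S with
  | declare d => rfl
  | weigh W next ih =>
    simp only [Strategy.trace, List.cons.injEq, List.replicate_succ] at h ⊢
    generalize W.place c = p at *
    cases p <;> simp_all [State.result, State.after]

/-- Starting states that are recognized together with the coin have distinct traces. -/
theorem Strategy.card_le_card_outcomes {N w : ℕ} (S : Strategy N w) (A : Finset (Fin N))
    (f : Fin N → State) (T : Finset (List Result)) (hrun : ∀ c ∈ A, S.run c (f c) = c)
    (hT : ∀ c ∈ A, outcomes (f c) w ⊆ T) : A.card ≤ T.card := by
  refine Finset.card_le_card_of_injOn (fun c => S.trace c (f c))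
    (fun c hc => hT c hc (S.trace_mem c _)) fun c hc d hd h => ?_
  rw [← hrun c hc, ← hrun d hd]
  exact S.run_eq_of_trace_eq h

theorem Strategy.card_add_card_le {N w : ℕ} (S : Strategy N w) (A : Finset (Fin N))
    (hl : ∀ c, S.run c .light = c) (hr : ∀ c ∈ A, S.run c .real = c) :
    N + A.card ≤ numL w + 1 := by
  classical
  set F := Finset.univ.image fun c => S.trace c .light
  set G := A.image fun c => S.trace c .real
  have hF : F.card = N := by
    rw [Finset.card_image_of_injective, Finset.card_univ, Fintype.card_fin]
    intro c d h
    rw [← hl c, ← hl d]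
    exact S.run_eq_of_trace_eq h
  have hG : G.card = A.card := by
    refine Finset.card_image_of_injOn fun c hc d hd h => ?_
    rw [← hr c hc, ← hr d hd]
    exact S.run_eq_of_trace_eq h
  have hFG : F ∩ G ⊆ {List.replicate w .bal} := by
    intro x hx
    simp only [F, G, Finset.mem_inter, Finset.mem_image, Finset.mem_univ, true_and] at hx
    obtain ⟨⟨c, rfl⟩, d, hd, h⟩ := hx
    obtain rfl : c = d := by
      rw [← hl c, ← hr d hd]
      exact S.run_eq_of_trace_eq h.symm
    exact Finset.mem_singleton.2 (S.trace_eq_replicate h.symm)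
  have hsub : F ∪ G ⊆ outcomes .light w := by
    refine Finset.union_subset ?_ ?_
    · exact Finset.image_subset_iff.2 fun c _ => S.trace_mem c _
    · exact Finset.image_subset_iff.2 fun c _ => outcomes_real_subset_light w (S.trace_mem c _)
  have h₁ := Finset.card_le_card hFG
  have h₂ := Finset.card_le_card hsub
  have h₃ := Finset.card_union_add_card_inter F G
  rw [Finset.card_singleton] at h₁
  change _ ≤ numL w at h₂
  omega

theorem Weighing.place_left {N : ℕ} {W : Weighing N} {c : Fin N} (h : c ∈ W.left) :
    W.place c = .left := if_pos h

theorem Weighing.place_right {N : ℕ} {W : Weighing N} {c : Fin N} (h : c ∈ W.right) :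
    W.place c = .right := by
  rw [Weighing.place, if_neg (Finset.disjoint_right.1 W.disjoint h), if_pos h]

theorem Weighing.place_outside {N : ℕ} {W : Weighing N} {c : Fin N} (h : c ∉ W.left)
    (h' : c ∉ W.right) : W.place c = .outside := by
  rw [Weighing.place, if_neg h, if_neg h']

/-- The number of coins on each pan in the first weighing satisfies these bounds. -/
theorem Strategy.FindsFake.bounds {N n : ℕ} {S : Strategy N (n + 1)} (hS : S.FindsFake) :
    N ≤ 1 ∨ ∃ a, 2 * a ≤ numHR n ∧ a ≤ numR n ∧ 2 * N ≤ 2 * a + numL n + 1 := by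
  classical
  cases S with
  | declare d =>
    left
    by_contra! h
    have h₀ := hS ⟨0, by omega⟩ .light
    have h₁ := hS ⟨1, h⟩ .light
    simp only [Strategy.run] at h₀ h₁
    simp [h₀] at h₁
  | weigh W next =>
    right
    have hl {c : Fin N} (hc : c ∈ W.left) : (next .lt).run c .heavy = c := by
      have := hS c .light
      rwa [Strategy.run, W.place_left hc] at this
    have hr {c : Fin N} (hc : c ∈ W.right) : (next .lt).run c .real = c := by
      have := hS c .heavy
      rwa [Strategy.run, W.place_right hc] at this
    refine ⟨W.left.card, ?_, ?_, ?_⟩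
    · have h := (next .lt).card_le_card_outcomes (W.left ∪ W.right)
        (fun c => if c ∈ W.left then .heavy else .real)
        (outcomes .heavy n ∪ outcomes .real n) ?_ ?_
      · rw [Finset.card_union_of_disjoint W.disjoint, ← W.card_eq, ← two_mul] at h
        exact h
      · intro c hc
        split_ifs with h
        · exact hl h
        · exact hr ((Finset.mem_union.1 hc).resolve_left h)
      · intro c _
        split_ifs
        · exact Finset.subset_union_left
        · exact Finset.subset_union_right
    · rw [W.card_eq]
      exact (next .lt).card_le_card_outcomes W.right (fun _ => .real) _ (fun c hc => hr hc)
        fun _ _ => subset_rfl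
    -- Real coins from the pans have turned light, so every coin can be light here.
    · have h := (next .bal).card_add_card_le (W.left ∪ W.right)ᶜ ?_ ?_
      · rw [Finset.card_compl, Finset.card_union_of_disjoint W.disjoint, ← W.card_eq,
          Fintype.card_fin] at h
        omega
      · intro c
        by_cases h₁ : c ∈ W.left
        · have := hS c .real
          rwa [Strategy.run, W.place_left h₁] at this
        by_cases h₂ : c ∈ W.right
        · have := hS c .real
          rwa [Strategy.run, W.place_right h₂] at this
        · have := hS c .light
          rwa [Strategy.run, W.place_outside h₁ h₂] at this
      · intro c hc
        simp only [Finset.mem_compl, Finset.mem_union, not_or] at hc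
        have := hS c .real
        rwa [Strategy.run, W.place_outside hc.1 hc.2] at this

/-! ### Positions and the effect of one weighing. -/

/-- Some strategy of `n` weighings identifies the fake coin if it is in `l` and starts light, or
in `h` and starts heavy, or in `r` and starts real. -/
def Solvable {N : ℕ} (n : ℕ) (l h r : Finset (Fin N)) : Prop :=
  ∃ S : Strategy N n, (∀ c ∈ l, S.run c .light = c) ∧ (∀ c ∈ h, S.run c .heavy = c) ∧
    ∀ c ∈ r, S.run c .real = c

theorem Solvable.mono {N n : ℕ} {l h r l' h' r' : Finset (Fin N)} (H : Solvable n l' h' r')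
    (hl : l ⊆ l') (hh : h ⊆ h') (hr : r ⊆ r') : Solvable n l h r :=
  let ⟨S, h₁, h₂, h₃⟩ := H
  ⟨S, fun c hc => h₁ c (hl hc), fun c hc => h₂ c (hh hc), fun c hc => h₃ c (hr hc)⟩

theorem Solvable.of_subset_singleton {N n : ℕ} {l h r : Finset (Fin N)} (d : Fin N)
    (hl : l ⊆ {d}) (hh : h ⊆ {d}) (hr : r ⊆ {d}) : Solvable n l h r :=
  ⟨.declare d, fun _ hc => (Finset.mem_singleton.1 (hl hc)).symm,
    fun _ hc => (Finset.mem_singleton.1 (hh hc)).symm,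
    fun _ hc => (Finset.mem_singleton.1 (hr hc)).symm⟩

theorem Solvable.weigh {N n : ℕ} {l h r P Q : Finset (Fin N)} (hPQ : Disjoint P Q)
    (hcard : P.card = Q.card)
    (hbal : Solvable n ((l \ (P ∪ Q)) ∪ (r ∩ (P ∪ Q))) (h \ (P ∪ Q)) (r \ (P ∪ Q)))
    (hlt : Solvable n ∅ (l ∩ P) (h ∩ Q)) (hgt : Solvable n ∅ (l ∩ Q) (h ∩ P)) :
    Solvable (n + 1) l h r := by
  obtain ⟨S₀, l₀, h₀, r₀⟩ := hbal
  obtain ⟨S₁, -, h₁, r₁⟩ := hlt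
  obtain ⟨S₂, -, h₂, r₂⟩ := hgt
  let W : Weighing N := ⟨P, Q, hPQ, hcard⟩
  let next : Result → Strategy N n := fun x => match x with
    | .bal => S₀
    | .lt => S₁
    | .gt => S₂
  simp only [Finset.mem_union, Finset.mem_sdiff, Finset.mem_inter] at l₀ h₀ r₀ h₁ r₁ h₂ r₂
  refine ⟨.weigh W next, ?_⟩
  simp only [Strategy.run]
  refine ⟨fun c hc => ?_, fun c hc => ?_, fun c hc => ?_⟩ <;>
  · by_cases hP : c ∈ P
    · rw [W.place_left hP]
      simp only [State.result, State.after, next]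
      grind
    · by_cases hQ : c ∈ Q
      · rw [W.place_right hQ]
        simp only [State.result, State.after, next]
        grind
      · rw [W.place_outside hP hQ]
        simp only [State.result, State.after, next]
        grind

/-- A genuine coin can be used to make up for one missing coin on a pan. -/
theorem Solvable.weigh_of_genuine {N n : ℕ} {l h r P Q : Finset (Fin N)} (hPQ : Disjoint P Q)
    {g : Fin N} (hP : P.card ≤ Q.card + 1) (hQ : Q.card ≤ P.card + 1) (gP : g ∉ P) (gQ : g ∉ Q)
    (gl : g ∉ l) (gh : g ∉ h) (gr : g ∉ r)
    (hbal : Solvable n ((l \ (P ∪ Q)) ∪ (r ∩ (P ∪ Q))) (h \ (P ∪ Q)) (r \ (P ∪ Q)))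
    (hlt : Solvable n ∅ (l ∩ P) (h ∩ Q)) (hgt : Solvable n ∅ (l ∩ Q) (h ∩ P)) :
    Solvable (n + 1) l h r := by
  have add {s : Finset (Fin N)} (hs : g ∉ s) (A : Finset (Fin N)) : s ∩ insert g A = s ∩ A :=
    Finset.inter_insert_of_notMem hs
  have sub {s : Finset (Fin N)} (hs : g ∉ s) (A : Finset (Fin N)) : s \ insert g A = s \ A :=
    Finset.sdiff_insert_of_notMem hs A
  obtain h₀ | h₀ | h₀ : P.card = Q.card ∨ P.card = Q.card + 1 ∨ Q.card = P.card + 1 := by omega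
  · exact .weigh hPQ h₀ hbal hlt hgt
  · refine .weigh (P := P) (Q := insert g Q) ?_ ?_ ?_ ?_ ?_
    · exact Finset.disjoint_insert_right.2 ⟨gP, hPQ⟩
    · rw [Finset.card_insert_of_notMem gQ, h₀]
    · rwa [Finset.union_insert, sub gl, sub gh, sub gr, add gr]
    · rwa [add gh]
    · rwa [add gl]
  · refine .weigh (P := insert g P) (Q := Q) ?_ ?_ ?_ ?_ ?_
    · exact Finset.disjoint_insert_left.2 ⟨gQ, hPQ⟩
    · rw [Finset.card_insert_of_notMem gP, h₀]
    · rwa [Finset.insert_union, sub gl, sub gh, sub gr, add gr]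
    · rwa [add gl]
    · rwa [add gh]

/-! ### Counting suffices once a genuine coin is known. -/

theorem exists_partition_three {α : Type*} [DecidableEq α] (s : Finset α) {a b c : ℕ}
    (h : s.card = a + b + c) : ∃ A B C : Finset α, s = A ∪ B ∪ C ∧ Disjoint A B ∧
      Disjoint A C ∧ Disjoint B C ∧ A.card = a ∧ B.card = b ∧ C.card = c := by
  obtain ⟨A, hA, rfl⟩ := Finset.exists_subset_card_eq (s := s) (n := a) (by omega)
  have h₁ := Finset.card_sdiff_add_card_eq_card hA
  obtain ⟨B, hB, rfl⟩ := Finset.exists_subset_card_eq (s := s \ A) (n := b) (by omega)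
  have h₂ := Finset.card_sdiff_add_card_eq_card hB
  refine ⟨A, B, (s \ A) \ B, ?_, ?_, ?_, ?_, rfl, rfl, by omega⟩
  · rw [Finset.union_assoc, Finset.union_sdiff_of_subset hB, Finset.union_sdiff_of_subset hA]
  · exact Finset.disjoint_sdiff.mono_right hB
  · exact Finset.disjoint_sdiff.mono_right Finset.sdiff_subset
  · exact Finset.disjoint_sdiff

/-- X light and Y heavy coins go on the scale. Halving both, one result leaves ⌈X/2⌉ + ⌈Y/2⌉
suspects, which exceeds HR exactly when X and Y are odd with X + Y = 2HR; the last clause excludes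
this. -/
theorem exists_even_split {L H R HL HR l h : ℕ} (hl : l ≤ L + 2 * H) (hh : h ≤ H + 2 * R)
    (hlh : l + h ≤ HL + 2 * HR) (h₁ : HL + 1 ≤ L + H) (h₂ : HR + 1 ≤ H + R) (h₃ : H ≤ HR)
    (h₄ : R ≤ HR) (h₅ : L ≤ HL) (h₆ : H ≤ HL) :
    ∃ X Y, X ≤ l ∧ X ≤ 2 * H ∧ l ≤ X + L ∧ Y ≤ h ∧ Y ≤ 2 * R ∧ h ≤ Y + H ∧
      l + h ≤ X + Y + HL ∧ X + Y ≤ 2 * HR ∧ (X % 2 = 0 ∨ Y % 2 = 0 ∨ X + Y + 2 ≤ 2 * HR) := by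
  obtain ⟨X, Y, a₁, a₂, a₃, a₄, a₅, a₆, a₇, a₈⟩ : ∃ X Y, X ≤ l ∧ X ≤ 2 * H ∧ l ≤ X + L ∧ Y ≤ h ∧
      Y ≤ 2 * R ∧ h ≤ Y + H ∧ l + h ≤ X + Y + HL ∧ X + Y ≤ 2 * HR := by
    -- Greedy choice: X leaves room for the h - H heavy coins that must be weighed, then Y fills up.
    refine ⟨min l (min (2 * H) (2 * HR - (h - H))),
      min h (min (2 * R) (2 * HR - min l (min (2 * H) (2 * HR - (h - H))))), ?_⟩
    omega
  by_cases hX : X % 2 = 0 ∨ Y % 2 = 0 ∨ X + Y + 2 ≤ 2 * HR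
  · exact ⟨X, Y, a₁, a₂, a₃, a₄, a₅, a₆, a₇, a₈, hX⟩
  -- In the bad parity case one coin is swapped or dropped; `h₁` ensures that there is slack for it.
  obtain h | h | h : (X < l ∧ h < Y + H) ∨ (l < X + L ∧ Y < h) ∨ (X = l ∧ Y = h) := by omega
  · exact ⟨X + 1, Y - 1, by omega⟩
  · exact ⟨X - 1, Y + 1, by omega⟩
  · exact ⟨X - 1, Y, by omega⟩

theorem inter_union_subset_left {α : Type*} [DecidableEq α] {s A B : Finset α}
    (h : Disjoint s B) : s ∩ (A ∪ B) ⊆ A := by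
  rw [Finset.inter_union_distrib_left, Finset.disjoint_iff_inter_eq_empty.1 h, Finset.union_empty]
  exact Finset.inter_subset_right

theorem inter_union_subset_right {α : Type*} [DecidableEq α] {s A B : Finset α}
    (h : Disjoint s A) : s ∩ (A ∪ B) ⊆ B := by
  rw [Finset.union_comm]
  exact inter_union_subset_left h

/-- With `g` genuine, light coins `l` and heavy coins `h` can be treated in `n` weighings as soon
as there are enough outcomes for them. -/
def LightHeavySolvable {N : ℕ} (g : Fin N) (n : ℕ) : Prop :=
  ∀ l h : Finset (Fin N), Disjoint l h → g ∉ l → g ∉ h → l.card ≤ numL n → h.card ≤ numH n →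
    l.card + h.card ≤ numHL n → Solvable n l h ∅

/-- With `g` genuine, heavy coins `h` and real coins `r` can be treated in `n` weighings as soon
as there are enough outcomes for them. -/
def HeavyRealSolvable {N : ℕ} (g : Fin N) (n : ℕ) : Prop :=
  ∀ h r : Finset (Fin N), Disjoint h r → g ∉ h → g ∉ r → h.card ≤ numH n → r.card ≤ numR n →
    h.card + r.card ≤ numHR n → Solvable n ∅ h r

theorem LightHeavySolvable.succ {N : ℕ} {g : Fin N} {n : ℕ} (ihA : LightHeavySolvable g n)
    (ihB : HeavyRealSolvable g n) : LightHeavySolvable g (n + 1) := by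
  have b₁ := numHL_numHR_lt n
  have b₂ := numH_le_numHR n
  have b₃ := numR_le_numHR n
  have b₄ := numL_le_numHL n
  have b₅ := numH_le_numHL n
  intro l h hd gl gh cl ch clh
  rw [numL_succ] at cl
  rw [numH_succ] at ch
  rw [numHL_succ] at clh
  obtain ⟨X, Y, a₁, a₂, a₃, a₄, a₅, a₆, a₇, a₈, a₉⟩ :=
    exists_even_split cl ch clh b₁.1 b₁.2 b₂ b₃ b₄ b₅
  obtain ⟨A, B, C, rfl, hAB, hAC, hBC, cA, cB, cC⟩ := exists_partition_three l
    (a := X - X / 2) (b := X / 2) (c := l.card - X) (by omega)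
  -- The larger half is now on the other pan, so that the pans differ by at most one coin.
  obtain ⟨A', B', C', rfl, hAB', hAC', hBC', cA', cB', cC'⟩ := exists_partition_three h
    (a := Y / 2) (b := Y - Y / 2) (c := h.card - Y) (by omega)
  have hd' := hd
  simp only [Finset.disjoint_union_left, Finset.disjoint_union_right] at hd'
  obtain ⟨⟨⟨⟨dAA, dBA⟩, dCA⟩, ⟨dAB, dBB⟩, dCB⟩, ⟨dAC, dBC⟩, dCC⟩ := hd'
  simp only [Finset.mem_union, not_or] at gl gh
  have cP : (A ∪ A').card = A.card + A'.card := Finset.card_union_of_disjoint dAA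
  have cQ : (B ∪ B').card = B.card + B'.card := Finset.card_union_of_disjoint dBB
  refine .weigh_of_genuine (P := A ∪ A') (Q := B ∪ B') (g := g) ?_ (by omega) (by omega)
    (by simp [*]) (by simp [*]) (by simp [*]) (by simp [*]) (by simp) ?_ ?_ ?_
  · exact Finset.disjoint_union_left.2 ⟨Finset.disjoint_union_right.2 ⟨hAB, dAB⟩,
      Finset.disjoint_union_right.2 ⟨dBA.symm, hAB'⟩⟩
  · refine (ihA C C' dCC gl.2 gh.2 (by omega) (by omega) (by omega)).mono ?_ ?_ ?_ <;>
    · clear * -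
      intro c
      simp
      try tauto
  · refine (ihB A B' dAB gl.1.1 gh.1.2 (by omega) (by omega) (by omega)).mono subset_rfl ?_ ?_
    · exact inter_union_subset_left (by simp [*])
    · exact inter_union_subset_right (by simp [*, dBA.symm, dBB.symm, dBC.symm])
  · refine (ihB B A' dBA gl.1.2 gh.1.1 (by omega) (by omega) (by omega)).mono subset_rfl ?_ ?_
    · exact inter_union_subset_left (by simp [*])
    · exact inter_union_subset_right (by simp [*, dAA.symm, dAB.symm, dAC.symm])

theorem HeavyRealSolvable.succ {N : ℕ} {g : Fin N} {n : ℕ} (ihA : LightHeavySolvable g n)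
    (ihB : HeavyRealSolvable g n) : HeavyRealSolvable g (n + 1) := by
  have b₃ := numR_le_numHR n
  have b₄ := numL_le_numHL n
  intro h r hd gh gr ch cr chr
  rw [numH_succ] at ch
  rw [numR_succ] at cr
  rw [numHR_succ] at chr
  obtain ⟨A, B, C, rfl, hAB, hAC, hBC, cA, cB, cC⟩ := exists_partition_three h
    (a := min h.card (2 * numR n) - min h.card (2 * numR n) / 2)
    (b := min h.card (2 * numR n) / 2) (c := h.card - min h.card (2 * numR n)) (by omega)
  -- All real coins are weighed: balance makes them light, which loses nothing.
  obtain ⟨A', B', C', rfl, hAB', hAC', hBC', cA', cB', cC'⟩ := exists_partition_three r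
    (a := r.card / 2) (b := r.card - r.card / 2) (c := 0) (by omega)
  obtain rfl := Finset.card_eq_zero.1 cC'
  simp only [Finset.union_empty] at *
  have hd' := hd
  simp only [Finset.disjoint_union_left, Finset.disjoint_union_right] at hd'
  obtain ⟨⟨⟨dAA, dBA⟩, dCA⟩, ⟨dAB, dBB⟩, dCB⟩ := hd'
  simp only [Finset.mem_union, not_or] at gh gr
  have cP : (A ∪ A').card = A.card + A'.card := Finset.card_union_of_disjoint dAA
  have cQ : (B ∪ B').card = B.card + B'.card := Finset.card_union_of_disjoint dBB
  refine .weigh_of_genuine (P := A ∪ A') (Q := B ∪ B') (g := g) ?_ (by omega) (by omega)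
    (by simp [*]) (by simp [*]) (by simp) (by simp [*]) (by simp [*]) ?_ ?_ ?_
  · exact Finset.disjoint_union_left.2 ⟨Finset.disjoint_union_right.2 ⟨hAB, dAB⟩,
      Finset.disjoint_union_right.2 ⟨dBA.symm, hAB'⟩⟩
  · refine (ihA (A' ∪ B') C ?_ (by simp [*]) gh.2 (by omega) (by omega)
      (by omega)).mono ?_ ?_ ?_
    · simp [dCA.symm, dCB.symm]
    all_goals
      clear * -
      intro c
      simp
      try tauto
  · refine (ihB ∅ B (by simp) (by simp) gh.1.2 (by simp) (by omega)
      (by rw [Finset.card_empty]; omega)).mono subset_rfl (by simp) ?_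
    exact inter_union_subset_left (by simp [*])
  · refine (ihB ∅ A (by simp) (by simp) gh.1.1 (by simp) (by omega)
      (by rw [Finset.card_empty]; omega)).mono subset_rfl (by simp) ?_
    exact inter_union_subset_left (by simp [*])

theorem lightHeavySolvable_and_heavyRealSolvable {N : ℕ} (g : Fin N) (n : ℕ) :
    LightHeavySolvable g n ∧ HeavyRealSolvable g n := by
  have : Nonempty (Fin N) := ⟨g⟩
  induction n with
  | zero =>
    constructor
    · intro l h hd _ _ _ _ hc
      rw [numHL_zero, ← Finset.card_union_of_disjoint hd,
        Finset.card_le_one_iff_subset_singleton] at hc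
      obtain ⟨d, hd⟩ := hc
      exact .of_subset_singleton d (Finset.union_subset_left hd) (Finset.union_subset_right hd)
        (by simp)
    · intro h r hd _ _ _ _ hc
      rw [numHR_zero, ← Finset.card_union_of_disjoint hd,
        Finset.card_le_one_iff_subset_singleton] at hc
      obtain ⟨d, hd⟩ := hc
      exact .of_subset_singleton d (by simp) (Finset.union_subset_left hd)
        (Finset.union_subset_right hd)
  | succ n ih => exact ⟨ih.1.succ ih.2, .succ ih.1 ih.2⟩

theorem heavyRealSolvable {N : ℕ} (g : Fin N) (n : ℕ) : HeavyRealSolvable g n :=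
  (lightHeavySolvable_and_heavyRealSolvable g n).2

/-! ### Coins of unknown state. -/

/-- Coins known to be light and one coin of unknown state, in the presence of a genuine coin. -/
theorem solvable_light_insert {N : ℕ} (g z : Fin N) (n : ℕ) (l : Finset (Fin N)) (gl : g ∉ l)
    (hgz : g ≠ z) (zl : z ∉ l) (hl : l.card + 1 ≤ numL n) : Solvable n (insert z l) {z} {z} := by
  induction n generalizing l with
  | zero =>
    rw [numL_zero] at hl
    obtain rfl := Finset.card_eq_zero.1 (show l.card = 0 by omega)
    exact .of_subset_singleton z (by simp) subset_rfl subset_rfl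
  | succ n ih =>
    rw [numL_succ] at hl
    have := one_le_numL n
    have := numH_le_numHR n
    obtain ⟨A, B, C, rfl, hAB, hAC, hBC, cA, cB, cC⟩ := exists_partition_three l
      (a := min l.card (2 * numH n) - min l.card (2 * numH n) / 2)
      (b := min l.card (2 * numH n) / 2) (c := l.card - min l.card (2 * numH n)) (by omega)
    simp only [Finset.mem_union, not_or] at gl zl
    -- The coin z stays outside; imbalance clears it, and the all-balanced outcome is reserved for
    -- it.
    refine .weigh_of_genuine (P := A) (Q := B) (g := g) hAB (by omega) (by omega)
      (by tauto) (by tauto) (by simp; tauto) (by simpa) (by simpa) ?_ ?_ ?_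
    · refine (ih C (by tauto) (by tauto) (by omega)).mono ?_ ?_ ?_ <;>
        · intro c; simp; grind
    · simp only [Finset.disjoint_left] at *
      refine (heavyRealSolvable g n A ∅ (by simp) (by tauto) (by simp) (by omega) (by simp)
        (by rw [Finset.card_empty]; omega)).mono ?_ ?_ ?_ <;> · intro c; simp; try grind
    · simp only [Finset.disjoint_left] at *
      refine (heavyRealSolvable g n B ∅ (by simp) (by tauto) (by simp) (by omega) (by simp)
        (by rw [Finset.card_empty]; omega)).mono ?_ ?_ ?_ <;> · intro c; simp; try grind

/-- The position after a balanced first weighing, with `D` the coins that were on the scale: the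
coins of `D` are now light, the others are of unknown state. In the second weighing all coins of
unknown state but one are put on the scale, and `m` coins in all on each pan. -/
theorem solvable_second {N n b m : ℕ} (D : Finset (Fin N)) (hD : D.card + b + 1 = N)
    (hmH : m ≤ numH n) (hbR : b - b / 2 ≤ numR n) (hmb : m + (b - b / 2) ≤ numHR n)
    (hbm : b - b / 2 ≤ m) (hpos : b + 1 ≤ 2 * m) (hm : 2 * m ≤ D.card + b)
    (hL : D.card + 2 * b + 1 ≤ numL n + 2 * m) : Solvable (n + 1) Finset.univ Dᶜ Dᶜ := by
  have hDc : Dᶜ.card = b + 1 := by rw [Finset.card_compl, Fintype.card_fin]; omega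
  obtain ⟨U, V, Z, hU, hUV, hUZ, hVZ, cU, cV, cZ⟩ := exists_partition_three Dᶜ
    (a := b / 2) (b := b - b / 2) (c := 1) (by omega)
  obtain ⟨z, rfl⟩ := Finset.card_eq_one.1 cZ
  obtain ⟨A, B, C, rfl, hAB, hAC, hBC, cA, cB, cC⟩ := exists_partition_three D
    (a := m - b / 2) (b := m - (b - b / 2)) (c := D.card + b - 2 * m) (by omega)
  have hd : Disjoint (A ∪ B ∪ C) (U ∪ V ∪ {z}) := hU ▸ disjoint_compl_right
  have huniv : (Finset.univ : Finset (Fin N)) = (A ∪ B ∪ C) ∪ (U ∪ V ∪ {z}) := by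
    rw [← hU, Finset.union_compl]
  rw [hU, huniv]
  simp only [Finset.disjoint_union_left, Finset.disjoint_union_right,
    Finset.disjoint_singleton_right, Finset.mem_union, not_or] at hd hUZ hVZ
  obtain ⟨⟨⟨⟨dAU, dBU⟩, dCU⟩, ⟨dAV, dBV⟩, dCV⟩, ⟨zA, zB⟩, zC⟩ := hd
  have cP : (A ∪ U).card = A.card + U.card := Finset.card_union_of_disjoint dAU
  have cQ : (B ∪ V).card = B.card + V.card := Finset.card_union_of_disjoint dBV
  have cR : (C ∪ (U ∪ V)).card = C.card + (U.card + V.card) := by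
    rw [Finset.card_union_of_disjoint, Finset.card_union_of_disjoint hUV]
    exact Finset.disjoint_union_right.2 ⟨dCU, dCV⟩
  -- Balance clears the weighed light coins, of which `hpos` guarantees one; imbalance clears z.
  obtain ⟨g, hg⟩ : (A ∪ B).Nonempty := by
    rw [← Finset.card_pos, Finset.card_union_of_disjoint hAB]
    omega
  have hgC : Disjoint (A ∪ B) C := Finset.disjoint_union_left.2 ⟨hAC, hBC⟩
  have hgU : Disjoint (A ∪ B) U := Finset.disjoint_union_left.2 ⟨dAU, dBU⟩
  have hgV : Disjoint (A ∪ B) V := Finset.disjoint_union_left.2 ⟨dAV, dBV⟩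
  have gC := Finset.disjoint_left.1 hgC hg
  have gU := Finset.disjoint_left.1 hgU hg
  have gV := Finset.disjoint_left.1 hgV hg
  have gz : g ≠ z := by rintro rfl; simp [zA, zB] at hg
  refine .weigh (P := A ∪ U) (Q := B ∪ V) ?_ (by omega) ?_ ?_ ?_
  · exact Finset.disjoint_union_left.2 ⟨Finset.disjoint_union_right.2 ⟨hAB, dAV⟩,
      Finset.disjoint_union_right.2 ⟨dBU.symm, hUV⟩⟩
  · refine (solvable_light_insert g z n (C ∪ (U ∪ V)) (by simp [*]) gz (by simp [*])
      (by omega)).mono ?_ ?_ ?_ <;>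
    · clear * -
      intro c
      simp
      tauto
  · refine (heavyRealSolvable z n (A ∪ U) V ?_ (by simp [*]) hVZ (by omega) (by omega)
      (by omega)).mono subset_rfl Finset.inter_subset_right ?_
    · simp [*]
    · exact inter_union_subset_right (by simp [zB, dBU.symm, dBV.symm])
  · refine (heavyRealSolvable z n (B ∪ V) U ?_ (by simp [*]) hUZ (by omega) (by omega)
      (by omega)).mono subset_rfl Finset.inter_subset_right ?_
    · simp [*, hUV.symm]
    · exact inter_union_subset_right (by simp [zA, dAU.symm, dAV.symm])

theorem solvable_first {N n a : ℕ} (haR : a ≤ numR n) (haHR : 2 * a ≤ numHR n) (haN : 2 * a < N)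
    (hbal : ∀ D : Finset (Fin N), D.card = 2 * a → Solvable n Finset.univ Dᶜ Dᶜ) :
    Solvable (n + 1) (Finset.univ : Finset (Fin N)) Finset.univ Finset.univ := by
  have haH := haR.trans (numR_le_numH n)
  obtain ⟨A, B, C, hU, hAB, hAC, hBC, cA, cB, cC⟩ := exists_partition_three
    (Finset.univ : Finset (Fin N)) (a := a) (b := a) (c := N - 2 * a)
    (by rw [Finset.card_univ, Fintype.card_fin]; omega)
  obtain ⟨g, hg⟩ : C.Nonempty := by rw [← Finset.card_pos]; omega
  have gA := Finset.disjoint_right.1 hAC hg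
  have gB := Finset.disjoint_right.1 hBC hg
  refine .weigh (P := A) (Q := B) hAB (by omega) ?_ ?_ ?_
  · refine (hbal (A ∪ B) ?_).mono (Finset.subset_univ _) ?_ ?_
    · rw [Finset.card_union_of_disjoint hAB]; omega
    · rw [Finset.compl_eq_univ_sdiff]
    · rw [Finset.compl_eq_univ_sdiff]
  · exact (heavyRealSolvable g n A B hAB gA gB (by omega) (by omega) (by omega)).mono
      subset_rfl Finset.inter_subset_right Finset.inter_subset_right
  · exact (heavyRealSolvable g n B A hAB.symm gB gA (by omega) (by omega) (by omega)).mono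
      subset_rfl Finset.inter_subset_right Finset.inter_subset_right

/-- Two coins leave no room for the general scheme; weighing them twice against each other gives six
different outcomes. -/
theorem solvable_two (n : ℕ) :
    Solvable (n + 2) (Finset.univ : Finset (Fin 2)) Finset.univ Finset.univ := by
  refine .weigh (P := {0}) (Q := {1}) (by simp) (by simp) ?_ ?_ ?_
  · refine .weigh (P := {0}) (Q := {1}) (by simp) (by simp) ?_ ?_ ?_
    · exact .of_subset_singleton 0 (by decide) (by decide) (by decide)
    · exact .of_subset_singleton 0 (by decide) (by decide) (by decide)
    · exact .of_subset_singleton 1 (by decide) (by decide) (by decide)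
  · refine .weigh (P := {0}) (Q := {1}) (by simp) (by simp) ?_ ?_ ?_
    · exact .of_subset_singleton 1 (by decide) (by decide) (by decide)
    · exact .of_subset_singleton 1 (by decide) (by decide) (by decide)
    · exact .of_subset_singleton 0 (by decide) (by decide) (by decide)
  · refine .weigh (P := {0}) (Q := {1}) (by simp) (by simp) ?_ ?_ ?_
    · exact .of_subset_singleton 0 (by decide) (by decide) (by decide)
    · exact .of_subset_singleton 1 (by decide) (by decide) (by decide)
    · exact .of_subset_singleton 0 (by decide) (by decide) (by decide)

theorem solvable_of_le {N n k : ℕ} (hn : 3 ≤ n) (hN : 3 ≤ N)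
    (hk : k = min (numHR (n + 1) / 2) (numR (n + 1))) (h : 2 * N ≤ 2 * k + numL (n + 1) + 1) :
    Solvable (n + 2) (Finset.univ : Finset (Fin N)) Finset.univ Finset.univ := by
  have r₁ := numHR_succ n
  have r₂ := numR_succ n
  have r₃ := numL_succ n
  have e₁ := numL_le_numHL n
  have e₂ := two_mul_numR_le n
  have e₃ := numH_le_three_mul_numR n (by omega)
  have e₄ := three_mul_numH_lt n hn
  have e₈ := numH_le_numL n
  have e₁₂ := numL_add_three_le n hn
  have e₁₁ : 3 ≤ numR n := by
    obtain ⟨m, rfl⟩ := Nat.exists_eq_add_of_le' hn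
    rw [numR_succ, numL_succ, numL_succ]
    have := one_le_numL m
    have := one_le_numH m
    omega
  -- The cap (N - 1) / 2 keeps a coin outside; b counts the other coins outside.
  obtain ⟨a, ha⟩ : ∃ a, a = min k ((N - 1) / 2) := ⟨_, rfl⟩
  obtain ⟨b, hb⟩ : ∃ b, b = N - 2 * a - 1 := ⟨_, rfl⟩
  have hbR : b ≤ 1 ∨ (b + numR n ≤ numH n ∧ a = k) := by omega
  refine solvable_first (a := a) (by omega) (by omega) (by omega) fun D hD => ?_
  -- Each pan takes half of the 2a + b available coins, or H_n if that is less, since all its coins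
  -- may become heavy suspects.
  refine solvable_second (b := b) (m := min (numH n) (a + b / 2)) D (by omega) (by omega)
    (by omega) ?_ ?_ ?_ (by omega) ?_
  · omega
  · omega
  · omega
  · omega

theorem exists_findsFake {N n : ℕ} (hn : 3 ≤ n) (hN : 1 ≤ N)
    (h : 2 * N ≤ 2 * min (numHR (n + 1) / 2) (numR (n + 1)) + numL (n + 1) + 1) :
    ∃ S : Strategy N (n + 2), S.FindsFake := by
  have hs : Solvable (n + 2) (Finset.univ : Finset (Fin N)) Finset.univ Finset.univ := by
    obtain rfl | rfl | hN : N = 1 ∨ N = 2 ∨ 3 ≤ N := by omega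
    · exact .of_subset_singleton 0 (by decide) (by decide) (by decide)
    · exact solvable_two n
    · exact solvable_of_le hn hN rfl h
  obtain ⟨S, h₁, h₂, h₃⟩ := hs
  refine ⟨S, fun c s => ?_⟩
  cases s
  · exact h₁ c (Finset.mem_univ c)
  · exact h₂ c (Finset.mem_univ c)
  · exact h₃ c (Finset.mem_univ c)

/-- HR_n is odd, so the rational (HR_n - 1) / 2 is the natural quotient `numHR n / 2`. -/
theorem le_kSeq_add_iff (N n : ℕ) : (N : ℚ) ≤ kSeq n + ((numL n : ℚ) + 1) / 2 ↔
    2 * N ≤ 2 * min (numHR n / 2) (numR n) + numL n + 1 := by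
  have h₁ : (((numHR n : ℚ) - 1) / 2) = ((numHR n / 2 : ℕ) : ℚ) := by
    have h : numHR n = 2 * (numHR n / 2) + 1 := by have := odd_numHR n; omega
    have h' : (numHR n : ℚ) = 2 * ((numHR n / 2 : ℕ) : ℚ) + 1 := by exact_mod_cast h
    linarith
  rw [kSeq, h₁, ← Nat.cast_min, ← Nat.cast_le (α := ℚ)]
  push_cast
  constructor <;> intro h <;> linarith

end LHRCoin

theorem mainTheorem2 (w : ℕ) (hw : 4 < w) (N : ℕ) (hN : 1 ≤ N) :
    (∃ S : LHRCoin.Strategy N w, S.FindsFake) ↔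
      (N : ℚ) ≤ LHRCoin.kSeq (w - 1) + ((LHRCoin.numL (w - 1) : ℚ) + 1) / 2 := by
  obtain ⟨n, rfl, hn⟩ : ∃ m, w = m + 2 ∧ 3 ≤ m := ⟨w - 2, by omega, by omega⟩
  rw [show n + 2 - 1 = n + 1 from rfl, LHRCoin.le_kSeq_add_iff]
  constructor
  · rintro ⟨S, hS⟩
    have := LHRCoin.one_le_numL (n + 1)
    obtain h | ⟨a, h₁, h₂, h₃⟩ := LHRCoin.Strategy.FindsFake.bounds hS
    · omega
    · omega
  · exact LHRCoin.exists_findsFake hn hN
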